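/- **Theorem 1.4.** Let $d\ge 1$, $r\in\mathbb N$, and write $|x-y|$ for the $\ell^\infty$ distance on $\mathbb Z^d$ and $K(x,y)=\langle\delta_x,K\delta_y\rangle$ for the matrix elements of a bounded operator $K$. Let $H=H_\omega$ be a random bounded self-adjoint operator on $\ell^2(\mathbb Z^d)$ (with measurable matrix elements) on a probability space $(\Omega,\mathbb P)$, and for $\beta>0$ let $$H(s)=H+\beta W(s),\qquad s\in[0,1],$$ where $W(s)$ (which may also depend on $\omega$) is self-adjoint. Assume the following. 1. *Smooth driving.* $H$ and $W(s)$ have range $r$, i.e. their matrix elements $(x,y)$ vanish if $|x-y|>r$; $s\mapsto W(s)$ is smooth on $[0,1]$ in operator norm; there are constants $C,C_k$ independent of $\omega$ and $s$ with $\|H\|\le C$ and $\|W^{(k)}(s)\|\le C_k$; and $W^{(k)}(0)=W^{(k+1)}(1)=0$ for all $k\in\mathbb N_0$. 2. *Finite range of disorder correlations.* For $\Theta\subset\mathbb Z^d$ let $H^\Theta$ be the restriction $\chi_\Theta H\chi_\Theta$ of $H$ to $\ell^2(\Theta)$. If $\mathrm{dist}(\Theta,\Phi)>r$, then $H^\Theta$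 and $H^\Phi$ are independent. 3. *Fractional moment condition on an interval $J_{loc}\subset\mathbb R$.* There are $q\in(0,1)$ and $C_q,c>0$ such that for every $\Theta\subset\mathbb Z^d$ $$\sup_{E\in J_{loc}}\mathbb E\left(\left|(H^\Theta-E-i0)^{-1}(x,y)\right|^q\right)\le C_q\,e^{-c|x-y|_\Theta},\qquad x,y\in\Theta,$$ where $|x-y|_\Theta=\min\bigl(|x-y|,\ \mathrm{dist}(x,\partial_1\Theta)+\mathrm{dist}(y,\partial_1\Theta)\bigr)$, $\partial_1\Theta=\{x\in\Theta:\mathrm{dist}(x,\Theta^c)=1\}$, and $\mathrm{dist}(x,\emptyset)=\infty$. Here $|(H^\Theta-E-i0)^{-1}(x,y)|^q$ is the limit (if it does not exist, the lower limit) of $|(H^\Theta-E-i\eta)^{-1}(x,y)|^q$ as $\eta\downarrow0$, with values in $[0,\infty]$. Fix real numbers $$p_1>2d+\tfrac12+\tfrac dq,\qquad p_2>\max\left(d+\tfrac12+\tfrac dq,\ \tfrac{2d}q\right),\qquad p=\tfrac{p_1}2 .$$ Let $E_F\in J_{loc}$, let $P_{E_F}(s)=\chi_{(-\infty,E_F]}(H(s))$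 be the spectral projection, and let $U_\epsilon(s)$ be the propagator, i.e. the solution of $$i\epsilon\,\partial_sU_\epsilon(s)=H(s)U_\epsilon(s),\qquad U_\epsilon(0)=1 .$$ Then, almost surely, for every $s\in[0,1]$ and every $\psi\in\ell^2(\mathbb Z^d)$, $$\left\|\bigl(U_\epsilon(s)P_{E_F}(0)U_\epsilon(s)^*-P_{E_F}(s)\bigr)\psi\right\|\longrightarrow0$$ as $(\epsilon,\beta)\to(0,0)$ within the region $\beta>0$, $e^{-1/\beta^{p}}<\epsilon<\beta^{p_2p_1}$. -/

import Mathlib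

open MeasureTheory ProbabilityTheory Filter Topology Set
open scoped ENNReal

noncomputable section

/-! ### Operators on `ℓ²(X)` -/

/-- The Hilbert space `ℓ²(X)` of square-summable complex functions on a set `X`. -/
def Ell2 (X : Type*) : Type _ := lp (fun _ : X => ℂ) 2

instance (X : Type*) : NormedAddCommGroup (Ell2 X) :=
  inferInstanceAs (NormedAddCommGroup (lp (fun _ : X => ℂ) 2))

instance (X : Type*) : InnerProductSpace ℂ (Ell2 X) :=
  inferInstanceAs (InnerProductSpace ℂ (lp (fun _ : X => ℂ) 2))

instance (X : Type*) : CompleteSpace (Ell2 X) :=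
  inferInstanceAs (CompleteSpace (lp (fun _ : X => ℂ) 2))

/-- The lattice `ℤ^d`; its distance `dist x y` is the `ℓ^∞` distance. -/
abbrev Zd (d : ℕ) : Type := Fin d → ℤ

/-- Bounded operators on `ℓ²(X)`. -/
abbrev Op (X : Type*) : Type _ := Ell2 X →L[ℂ] Ell2 X

/-- The canonical basis vector `δ_x` of `ℓ²(X)`. -/
def delta {X : Type*} [DecidableEq X] (x : X) : Ell2 X :=
  (lp.single 2 x (1 : ℂ) : lp (fun _ : X => ℂ) 2)

/-- The matrix element `K(x, y) = ⟨δ_x, K δ_y⟩`. -/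
def kernel {X : Type*} [DecidableEq X] (K : Op X) (x y : X) : ℂ :=
  inner ℂ (delta x) (K (delta y))

theorem orthonormal_delta (X : Type*) [DecidableEq X] :
    Orthonormal ℂ (fun x : X => (delta x : Ell2 X)) := by
  constructor
  · intro x
    exact (lp.norm_single (E := fun _ : X => ℂ) (p := 2) (by norm_num) x (1 : ℂ)).trans norm_one
  · intro x y hxy
    have h : inner ℂ (lp.single 2 x (1 : ℂ) : lp (fun _ : X => ℂ) 2)
        (lp.single 2 y (1 : ℂ) : lp (fun _ : X => ℂ) 2) = 0 := by
      rw [lp.inner_single_left, lp.single_apply_ne _ _ _ hxy, inner_zero_right]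
    exact h

/-- The isometric inclusion `ℓ²(Θ) → ℓ²(X)` of a subset, i.e. extension by zero:
it maps `δ_x` to `δ_x` for `x ∈ Θ`. -/
def extendByZero {X : Type*} [DecidableEq X] (Θ : Set X) : Ell2 Θ →ₗᵢ[ℂ] Ell2 X :=
  ((orthonormal_delta X).comp (Subtype.val : Θ → X)
    Subtype.val_injective).orthogonalFamily.linearIsometry

/-- The canonical restriction `K^Θ = χ_Θ K χ_Θ`, as an operator on `ℓ²(Θ)`. -/
def restrictTo {X : Type*} [DecidableEq X] (K : Op X) (Θ : Set X) : Op Θ :=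
  (ContinuousLinearMap.adjoint (extendByZero Θ).toContinuousLinearMap).comp
    (K.comp (extendByZero Θ).toContinuousLinearMap)

/-- `K` has range `r` if `K(x, y) = 0` whenever `|x - y| > r`. -/
def HasRange {d : ℕ} (r : ℕ) (K : Op (Zd d)) : Prop :=
  ∀ x y : Zd d, (r : ℝ) < dist x y → kernel K x y = 0

/-- The spectral projection `P_E(A) = χ_{(-∞, E]}(A)` of a bounded self-adjoint operator `A`.
Since `λ ≤ E` if and only if `(λ - E)₊ = 0`, it is the orthogonal projection onto the kernel of
`(A - E)₊`, where `(A - E)₊` is given by the continuous functional calculus. -/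
def specProj {X : Type*} (A : Op X) (E : ℝ) : Op X :=
  (cfc (fun t : ℝ => max (t - E) 0) A : Op X).ker.starProjection

/-! ### The propagator -/

/-- `U` solves `i ε ∂_s U(s) = A(s) U(s)`, `U(0) = 1`, on `[0, 1]`. -/
def IsPropagator {X : Type*} (ε : ℝ) (A : ℝ → Op X) (U : ℝ → Op X) : Prop :=
  U 0 = 1 ∧ ∀ s ∈ Icc (0 : ℝ) 1, ∃ U' : Op X,
    HasDerivWithinAt U U' (Icc 0 1) s ∧ (Complex.I * (ε : ℂ)) • U' = A s * U s

section Dyson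

variable {R : Type*} [NormedRing R] [NormedAlgebra ℝ R]

/-- The terms of the Dyson series of `U' = B U`, `U(0) = 1`. -/
def dysonTerm (B : ℝ → R) : ℕ → ℝ → R
  | 0 => fun _ => 1
  | n + 1 => fun t => ∫ τ in (0 : ℝ)..t, B τ * dysonTerm B n τ

theorem continuous_dysonTerm {B : ℝ → R} (hB : Continuous B) :
    ∀ n, Continuous (dysonTerm B n)
  | 0 => continuous_const
  | n + 1 => by
    have h := continuous_dysonTerm hB n
    exact intervalIntegral.continuous_primitive
      (fun a b => (hB.mul h).intervalIntegrable a b) 0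

theorem hasDerivAt_dysonTerm_succ [CompleteSpace R] {B : ℝ → R} (hB : Continuous B) (n : ℕ) (t : ℝ) :
    HasDerivAt (dysonTerm B (n + 1)) (B t * dysonTerm B n t) t :=
  ((hB.mul (continuous_dysonTerm hB n)).integral_hasStrictDerivAt 0 t).hasDerivAt

theorem norm_dysonTerm_le [CompleteSpace R] {B : ℝ → R} (hB : Continuous B) {M : ℝ} (hM : ∀ t, ‖B t‖ ≤ M) (n : ℕ) :
    ∀ t ∈ Icc (0 : ℝ) 2, ‖dysonTerm B n t‖ ≤ ‖(1 : R)‖ * ((M * t) ^ n / n.factorial) := by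
  have hM0 : 0 ≤ M := (norm_nonneg _).trans (hM 0)
  induction n with
  | zero => intro t _; simp [dysonTerm]
  | succ n ih =>
    intro t ht
    have hd : ∀ x : ℝ, HasDerivAt (fun t : ℝ => ‖(1 : R)‖ * ((M * t) ^ (n + 1) / (n + 1).factorial))
        (‖(1 : R)‖ * (M * ((M * x) ^ n / n.factorial))) x := by
      intro x
      have h1 : HasDerivAt (fun t : ℝ => M * t) M x := by
        simpa using (hasDerivAt_id x).const_mul M
      have h2 := ((h1.pow (n + 1)).div_const ((n + 1).factorial : ℝ)).const_mul ‖(1 : R)‖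
      refine h2.congr_deriv ?_
      rw [Nat.factorial_succ]
      push_cast
      have : (n.factorial : ℝ) ≠ 0 := by positivity
      have : (n : ℝ) + 1 ≠ 0 := by positivity
      field_simp
    refine image_norm_le_of_norm_deriv_right_le_deriv_boundary
      (f := dysonTerm B (n + 1)) (f' := fun x => B x * dysonTerm B n x) (a := 0) (b := 2)
      (continuous_dysonTerm hB (n + 1)).continuousOn
      (fun x _ => (hasDerivAt_dysonTerm_succ hB n x).hasDerivWithinAt) ?_ hd ?_ ht
    · simp [dysonTerm]
    · intro x hx
      refine (norm_mul_le _ _).trans ?_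
      have := ih x ⟨hx.1, hx.2.le⟩
      calc ‖B x‖ * ‖dysonTerm B n x‖ ≤ M * (‖(1 : R)‖ * ((M * x) ^ n / n.factorial)) :=
            mul_le_mul (hM x) this (norm_nonneg _) hM0
        _ = _ := by ring

theorem dysonTerm_neg (B : ℝ → R) (n : ℕ) :
    ∀ t, dysonTerm B n (-t) = dysonTerm (fun τ => -B (-τ)) n t := by
  induction n with
  | zero => intro t; rfl
  | succ n ih =>
    intro t
    have h := intervalIntegral.integral_comp_neg (a := (0 : ℝ)) (b := t)
      (fun τ => B τ * dysonTerm B n τ)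
    simp only [dysonTerm]
    rw [neg_zero] at h
    rw [intervalIntegral.integral_symm, ← h, ← intervalIntegral.integral_neg]
    refine intervalIntegral.integral_congr fun τ _ => ?_
    simp [ih]

theorem norm_dysonTerm_le' [CompleteSpace R] {B : ℝ → R} (hB : Continuous B) {M : ℝ} (hM : ∀ t, ‖B t‖ ≤ M) (n : ℕ)
    (t : ℝ) (ht : t ∈ Ioo (-2 : ℝ) 2) :
    ‖dysonTerm B n t‖ ≤ ‖(1 : R)‖ * ((M * 2) ^ n / n.factorial) := by
  have hM0 : 0 ≤ M := (norm_nonneg _).trans (hM 0)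
  have key : ∀ (B' : ℝ → R), Continuous B' → (∀ t, ‖B' t‖ ≤ M) → ∀ t ∈ Icc (0 : ℝ) 2,
      ‖dysonTerm B' n t‖ ≤ ‖(1 : R)‖ * ((M * 2) ^ n / n.factorial) := by
    intro B' hB' hM' t ht
    refine (norm_dysonTerm_le hB' hM' n t ht).trans ?_
    have h0 := ht.1
    have h2 := ht.2
    gcongr
  rcases le_total 0 t with h | h
  · exact key B hB hM t ⟨h, ht.2.le⟩
  · have h' := dysonTerm_neg B n (-t)
    rw [neg_neg] at h'
    rw [h']
    exact key _ (by fun_prop) (fun t => by simpa using hM _) (-t) ⟨by linarith, by linarith [ht.1]⟩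

/-- Linear initial value problems with continuous bounded coefficients are solvable. -/
theorem exists_linear_ivp [CompleteSpace R] {B : ℝ → R} (hB : Continuous B) {M : ℝ} (hM : ∀ t, ‖B t‖ ≤ M) :
    ∃ U : ℝ → R, U 0 = 1 ∧ ∀ s ∈ Icc (0 : ℝ) 1, HasDerivAt U (B s * U s) s := by
  have hsum : Summable fun n : ℕ => ‖(1 : R)‖ * ((M * 2) ^ n / n.factorial) :=
    (Real.summable_pow_div_factorial (M * 2)).mul_left _
  have hD : ∀ t ∈ Ioo (-2 : ℝ) 2, Summable fun n => dysonTerm B n t := fun t ht =>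
    Summable.of_norm_bounded hsum fun n => norm_dysonTerm_le' hB hM n t ht
  have h0 : (0 : ℝ) ∈ Ioo (-2 : ℝ) 2 := by constructor <;> norm_num
  refine ⟨fun t => 1 + ∑' n, dysonTerm B (n + 1) t, ?_, ?_⟩
  · simp [dysonTerm]
  · intro s hs
    have hs' : s ∈ Ioo (-2 : ℝ) 2 := ⟨by linarith [hs.1], by linarith [hs.2]⟩
    have h := hasDerivAt_tsum_of_isPreconnected (hsum.mul_left M) isOpen_Ioo
      isPreconnected_Ioo (g := fun n => dysonTerm B (n + 1))
      (g' := fun n t => B t * dysonTerm B n t)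
      (fun n t _ => hasDerivAt_dysonTerm_succ hB n t)
      (fun n t ht => (norm_mul_le _ _).trans
        (mul_le_mul (hM t) (norm_dysonTerm_le' hB hM n t ht) (norm_nonneg _)
          ((norm_nonneg _).trans (hM 0))))
      h0 ((summable_nat_add_iff 1).2 (hD 0 h0)) hs'
    refine (h.const_add 1).congr_deriv ?_
    rw [(hD s hs').tsum_mul_left, (hD s hs').tsum_eq_zero_add]
    rfl

end Dyson

/-- The propagator exists as soon as the generator is norm continuous. -/
theorem exists_isPropagator {X : Type*} {ε : ℝ} (hε : ε ≠ 0) {A : ℝ → Op X}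
    (hA : ContinuousOn A (Icc 0 1)) : ∃ U, IsPropagator ε A U := by
  have hc : Continuous fun t : ℝ => (Complex.I * (ε : ℂ))⁻¹ • A (projIcc (0 : ℝ) 1 zero_le_one t) :=
    ((continuousOn_iff_continuous_domRestrict.1 hA).comp continuous_projIcc).const_smul
      ((Complex.I * (ε : ℂ))⁻¹)
  obtain ⟨M, hM⟩ := isCompact_Icc.exists_bound_of_continuousOn
    (hA.const_smul ((Complex.I * (ε : ℂ))⁻¹))
  obtain ⟨U, hU0, hU⟩ := exists_linear_ivp hc (fun t => hM _ (projIcc (0 : ℝ) 1 zero_le_one t).2)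
  refine ⟨U, hU0, fun s hs => ⟨_, (hU s hs).hasDerivWithinAt, ?_⟩⟩
  have hne : Complex.I * (ε : ℂ) ≠ 0 := mul_ne_zero Complex.I_ne_zero (by exact_mod_cast hε)
  rw [projIcc_of_mem zero_le_one hs, smul_mul_assoc, smul_inv_smul₀ hne]

/-- The solution of the initial value problem is unique on `[0, 1]`. -/
theorem IsPropagator.eqOn {X : Type*} {ε : ℝ} (hε : ε ≠ 0) {A : ℝ → Op X}
    (hA : ContinuousOn A (Icc 0 1)) {U V : ℝ → Op X} (hU : IsPropagator ε A U)
    (hV : IsPropagator ε A V) : EqOn U V (Icc 0 1) := by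
  have hne : Complex.I * (ε : ℂ) ≠ 0 := mul_ne_zero Complex.I_ne_zero (by exact_mod_cast hε)
  obtain ⟨M, hM⟩ := isCompact_Icc.exists_bound_of_continuousOn
    (hA.const_smul ((Complex.I * (ε : ℂ))⁻¹))
  have hder : ∀ {U : ℝ → Op X}, IsPropagator ε A U → ∀ s ∈ Icc (0 : ℝ) 1,
      HasDerivWithinAt U (((Complex.I * (ε : ℂ))⁻¹ • A s) * U s) (Icc 0 1) s := by
    intro U hU s hs
    obtain ⟨U', h1, h2⟩ := hU.2 s hs
    rwa [smul_mul_assoc, ← h2, inv_smul_smul₀ hne]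
  have hlip : ∀ t ∈ Ico (0 : ℝ) 1, LipschitzOnWith M.toNNReal
      (fun x : Op X => ((Complex.I * (ε : ℂ))⁻¹ • A t) * x) univ := by
    intro t ht
    refine LipschitzWith.lipschitzOnWith (LipschitzWith.of_dist_le_mul fun x y => ?_)
    rw [dist_eq_norm, dist_eq_norm, ← mul_sub]
    refine (norm_mul_le _ _).trans ?_
    gcongr
    exact (hM t ⟨ht.1, ht.2.le⟩).trans (Real.le_coe_toNNReal M)
  have hright : ∀ {U : ℝ → Op X}, IsPropagator ε A U → ∀ s ∈ Ico (0 : ℝ) 1,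
      HasDerivWithinAt U (((Complex.I * (ε : ℂ))⁻¹ • A s) * U s) (Ici s) s := fun hU s hs =>
    (hder hU s ⟨hs.1, hs.2.le⟩).mono_of_mem_nhdsWithin (Icc_mem_nhdsGE_of_mem hs)
  exact ODE_solution_unique_of_mem_Icc_right hlip
    (fun s hs => (hder hU s hs).continuousWithinAt) (hright hU) (fun _ _ => mem_univ _)
    (fun s hs => (hder hV s hs).continuousWithinAt) (hright hV) (fun _ _ => mem_univ _)
    (hU.1.trans hV.1.symm)

open Classical in
/-- The propagator `U_ε(s)`: the solution of `i ε ∂_s U(s) = A(s) U(s)`, `U(0) = 1`. For `ε ≠ 0` and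
norm continuous `A` it exists and is unique on `[0, 1]`; otherwise the value is irrelevant. -/
def propagator {X : Type*} (ε : ℝ) (A : ℝ → Op X) : ℝ → Op X :=
  if h : ∃ U, IsPropagator ε A U then h.choose else fun _ => 1

theorem propagator_spec {X : Type*} {ε : ℝ} (hε : ε ≠ 0) {A : ℝ → Op X}
    (hA : ContinuousOn A (Icc 0 1)) : IsPropagator ε A (propagator ε A) := by
  have h := exists_isPropagator hε hA
  rw [propagator, dif_pos h]
  exact h.choose_spec

/-! ### The three assumptions -/

/-- The driven Hamiltonian `H(s) = H + β W(s)`. -/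
def drivenH {X : Type*} (H : Op X) (W : ℝ → Op X) (β s : ℝ) : Op X := H + (β : ℂ) • W s

/-- Smooth driving: `H(s) = H + β W(s)` is a uniformly bounded, norm-smooth family of range-`r`
self-adjoint operators on `ℓ²(ℤ^d)`, with bounds that do not depend on the disorder `ω`. The
derivatives on `[0, 1]` satisfy `‖W^(k)(s)‖ ≤ C_k` and `W^(k)(0) = W^(k+1)(1) = 0`. Bounds,
self-adjointness and range are stated for `H` and `W(s)` separately, which is the same since
`W(0) = 0`. -/
structure SmoothDriving {d : ℕ} {Ω : Type*} (r : ℕ) (H : Ω → Op (Zd d))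
    (W : Ω → ℝ → Op (Zd d)) : Prop where
  isSelfAdjoint_H : ∀ ω, IsSelfAdjoint (H ω)
  isSelfAdjoint_W : ∀ ω, ∀ s ∈ Icc (0 : ℝ) 1, IsSelfAdjoint (W ω s)
  hasRange_H : ∀ ω, HasRange r (H ω)
  hasRange_W : ∀ ω, ∀ s ∈ Icc (0 : ℝ) 1, HasRange r (W ω s)
  bound_H : ∃ C : ℝ, ∀ ω, ‖H ω‖ ≤ C
  smooth_W : ∀ ω, ContDiffOn ℝ (⊤ : ℕ∞) (W ω) (Icc 0 1)
  bound_W : ∃ C : ℕ → ℝ, ∀ k ω, ∀ s ∈ Icc (0 : ℝ) 1,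
    ‖iteratedDerivWithin k (W ω) (Icc 0 1) s‖ ≤ C k
  deriv_zero : ∀ k ω, iteratedDerivWithin k (W ω) (Icc 0 1) 0 = 0
  deriv_one : ∀ k ω, iteratedDerivWithin (k + 1) (W ω) (Icc 0 1) 1 = 0

/-- Finite range of disorder correlations: if `dist(Θ, Φ) > r`, then `H^Θ` and `H^Φ` (that is,
their families of matrix elements) are independent. -/
def FiniteRangeCorrelations {d : ℕ} {Ω : Type*} [MeasurableSpace Ω] (r : ℕ)
    (H : Ω → Op (Zd d)) (μ : Measure Ω) : Prop :=
  ∀ Θ Φ : Set (Zd d), (∀ x ∈ Θ, ∀ y ∈ Φ, (r : ℝ) < dist x y) →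
    IndepFun (fun ω (p : Θ × Θ) => kernel (restrictTo (H ω) Θ) p.1 p.2)
      (fun ω (p : Φ × Φ) => kernel (restrictTo (H ω) Φ) p.1 p.2) μ

/-- The interior boundary `∂₁Θ = {x ∈ Θ : dist(x, Θᶜ) = 1}` (empty for `Θ = ℤ^d`). -/
def innerBoundary {d : ℕ} (Θ : Set (Zd d)) : Set (Zd d) :=
  {x ∈ Θ | Metric.infEDist x Θᶜ = 1}

/-- `|x - y|_Θ = min (|x - y|, dist(x, ∂₁Θ) + dist(y, ∂₁Θ))`, with distance `∞` to the empty set. -/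
def bulkDist {d : ℕ} (Θ : Set (Zd d)) (x y : Zd d) : ℝ :=
  (min (edist x y)
    (Metric.infEDist x (innerBoundary Θ) + Metric.infEDist y (innerBoundary Θ))).toReal

/-- The Green function `(K - z)⁻¹(x, y)`; for self-adjoint `K` it is used at `Im z > 0`, where
`K - z` is invertible. -/
def green {X : Type*} [DecidableEq X] (K : Op X) (z : ℂ) (x y : X) : ℂ :=
  kernel (Ring.inverse (K - z • (1 : Op X))) x y

/-- `|(K - E - i0)⁻¹(x, y)|^q`, i.e. the limit of `|(K - E - iη)⁻¹(x, y)|^q` as `η → 0+`, in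
`[0, ∞]`. It is written as a lower limit, so that it is defined without assuming that the limit
exists. -/
def greenBoundaryPow {X : Type*} [DecidableEq X] (K : Op X) (E q : ℝ) (x y : X) : ℝ≥0∞ :=
  liminf (fun η : ℝ => ‖green K ((E : ℂ) + (η : ℂ) * Complex.I) x y‖ₑ ^ q) (𝓝[>] 0)

/-- Fractional moment condition with exponent `q` on the energy set `J`: there are `C_q, c > 0` such
that, for all `Θ ⊆ ℤ^d`, `E ∈ J` and `x, y ∈ Θ`,
`𝔼 |(H^Θ - E - i0)⁻¹(x, y)|^q ≤ C_q exp(-c |x - y|_Θ)`. -/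
def FractionalMoment {d : ℕ} {Ω : Type*} [MeasurableSpace Ω] (q : ℝ) (J : Set ℝ)
    (H : Ω → Op (Zd d)) (μ : Measure Ω) : Prop :=
  ∃ C c : ℝ, 0 < C ∧ 0 < c ∧ ∀ Θ : Set (Zd d), ∀ E ∈ J, ∀ x y : Θ,
    ∫⁻ ω, greenBoundaryPow (restrictTo (H ω) Θ) E q x y ∂μ
      ≤ ENNReal.ofReal (C * Real.exp (-c * bulkDist Θ x y))

/-! ### The regime of parameters -/

/-- Parameters `(ε, β)` with `β > 0` and `exp(-1/β^(p₁/2)) < ε < β^(p₂ p₁)`. -/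
def adiabaticRegime (p₁ p₂ : ℝ) : Set (ℝ × ℝ) :=
  {a | 0 < a.2 ∧ Real.exp (-(1 / a.2 ^ (p₁ / 2))) < a.1 ∧ a.1 < a.2 ^ (p₂ * p₁)}

end

/-! ### Strong convergence of spectral projections -/

section StrongConvergence

variable {E : Type*} [NormedAddCommGroup E] [InnerProductSpace ℂ E]

/-! Strong convergence under weak driving needs neither a spectral gap nor a rate in `ε`; two facts
suffice.

First, almost surely `E_F` is not an eigenvalue of `H`. If an eigenvector had a nonzero component at
`x`, the diagonal Green function at `E_F + iη` would be at least `c/η`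
(`le_norm_green_of_eigenvector`), and a finite fractional moment allows this only on a null set. A
union over the countably many sites gives `FractionalMoment.ae_not_eigenvalue`.

Second, the energy balance `∂_s (U^* H(s) U) = β U^* W'(s) U` shows that `U H(0) U^*` stays within
`β sup ‖W'‖` of `H(s)`, whatever the size of `ε` (`IsPropagator.norm_conj_sub_le`). As `β → 0`, both
operators converge to `H` in norm.

The evolved projection `U P(0) U^*` plays the role of spectral projection for `U H(0) U^*`, and
`P(s)` for `H(s)`. Norm convergence of operators gives strong convergence of such projections when
the threshold is not an eigenvalue of the limit (`tendsto_specProj_of_mul_eq`). Both projections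
therefore tend strongly to `P_{E_F}(H)`, and their difference tends to zero. -/

theorem ContinuousLinearMap.dense_range_sup_range [CompleteSpace E] {F G : E →L[ℂ] E} (hF : IsSelfAdjoint F)
    (hG : IsSelfAdjoint G) (hker : ∀ v, F v = 0 → G v = 0 → v = 0) :
    Dense ((F.range ⊔ G.range : Submodule ℂ E) : Set E) := by
  -- For self-adjoint `T` the orthogonal complement of the range is the kernel; hence a vector
  -- orthogonal to both ranges lies in both kernels.
  have hself : ∀ {T : E →L[ℂ] E}, IsSelfAdjoint T → ∀ x : E,
      (∀ y, inner ℂ (T y) x = 0) → T x = 0 := by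
    intro T hT x h
    rw [← inner_self_eq_zero (𝕜 := ℂ)]
    have h1 := hT.isSymmetric (T x) x
    simp only [ContinuousLinearMap.coe_coe] at h1
    rw [← h1]
    exact h _
  rw [Submodule.dense_iff_topologicalClosure_eq_top, Submodule.topologicalClosure_eq_top_iff,
    Submodule.eq_bot_iff]
  intro x hx
  rw [Submodule.mem_orthogonal] at hx
  exact hker x
    (hself hF x fun y => hx _ (Submodule.mem_sup_left ⟨y, rfl⟩))
    (hself hG x fun y => hx _ (Submodule.mem_sup_right ⟨y, rfl⟩))

/-- Contractions that annihilate `F` and fix `G` converge strongly, if `F`, `G` converge in norm and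
the limiting ranges span a dense subspace. -/
theorem tendsto_apply_of_mul_eq {ι : Type*} {l : Filter ι} {F G Q : E →L[ℂ] E}
    {Fn Gn Qn : ι → E →L[ℂ] E} (hF : Tendsto Fn l (𝓝 F)) (hG : Tendsto Gn l (𝓝 G))
    (hQn : ∀ᶠ n in l, ‖Qn n‖ ≤ 1 ∧ Qn n * Fn n = 0 ∧ Qn n * Gn n = Gn n)
    (hQ : ‖Q‖ ≤ 1) (hQF : Q * F = 0) (hQG : Q * G = G)
    (hdense : Dense ((F.range ⊔ G.range : Submodule ℂ E) : Set E)) (ψ : E) :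
    Tendsto (fun n => Qn n ψ) l (𝓝 (Q ψ)) := by
  have hnorm : ∀ᶠ n in l, ‖Qn n‖ ≤ 1 := hQn.mono fun n h => h.1
  have hbdd : ∀ᶠ n in l, ∀ x, ‖Qn n x‖ ≤ ‖x‖ := hnorm.mono fun n h x =>
    ((Qn n).le_of_opNorm_le h x).trans_eq (one_mul _)
  -- The uniform bound on `Qn` lets `T y` be traded for `Tn n y`, on which the algebraic relations
  -- determine `Qn n`.
  have hsmall : ∀ {T : E →L[ℂ] E} {Tn : ι → E →L[ℂ] E}, Tendsto Tn l (𝓝 T) → ∀ y : E,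
      Tendsto (fun n => Qn n (T y - Tn n y)) l (𝓝 0) := by
    intro T Tn hT y
    have h0 : Tendsto (fun n => ‖T y - Tn n y‖) l (𝓝 0) := by
      have h1 : Tendsto (fun n => Tn n y) l (𝓝 (T y)) :=
        ((ContinuousLinearMap.apply ℂ E y).continuous.tendsto T).comp hT
      simpa using (h1.const_sub (T y)).norm
    exact squeeze_zero_norm' (hbdd.mono fun n h => h _) h0
  have hFc : ∀ y, Tendsto (fun n => Qn n (F y)) l (𝓝 (Q (F y))) := by
    intro y
    have h0 : Q (F y) = 0 := by rw [← mul_apply_eq_comp, hQF]; rfl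
    rw [h0]
    refine (hsmall hF y).congr' (hQn.mono fun n h => ?_)
    have h1 : Qn n (Fn n y) = 0 := by rw [← mul_apply_eq_comp, h.2.1]; rfl
    simp [h1]
  have hGc : ∀ y, Tendsto (fun n => Qn n (G y)) l (𝓝 (Q (G y))) := by
    intro y
    have h0 : Q (G y) = G y := by rw [← mul_apply_eq_comp, hQG]
    rw [h0]
    have h1 : Tendsto (fun n => Gn n y) l (𝓝 (G y)) :=
      ((ContinuousLinearMap.apply ℂ E y).continuous.tendsto G).comp hG
    have h2 := (hsmall hG y).add h1
    rw [zero_add] at h2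
    refine h2.congr' (hQn.mono fun n h => ?_)
    have h1 : Qn n (Gn n y) = Gn n y := by rw [← mul_apply_eq_comp, h.2.2]
    simp [h1]
  have hspan : ∀ φ ∈ F.range ⊔ G.range, Tendsto (fun n => Qn n φ) l (𝓝 (Q φ)) := by
    intro φ hφ
    obtain ⟨_, ⟨y, rfl⟩, _, ⟨z, rfl⟩, rfl⟩ := Submodule.mem_sup.1 hφ
    simpa using (hFc y).add (hGc z)
  rw [Metric.tendsto_nhds]
  intro e he
  obtain ⟨φ, hφ, hd⟩ := hdense.exists_dist_lt ψ (by positivity : 0 < e / 3)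
  rw [dist_eq_norm] at hd
  filter_upwards [hbdd, Metric.tendsto_nhds.1 (hspan φ hφ) (e / 3) (by positivity)] with n h1 h2
  have h3 : ‖Q (ψ - φ)‖ ≤ ‖ψ - φ‖ := (Q.le_of_opNorm_le hQ _).trans_eq (one_mul _)
  rw [dist_eq_norm] at h2 ⊢
  have h4 : Qn n ψ - Q ψ = Qn n (ψ - φ) + (Qn n φ - Q φ) - Q (ψ - φ) := by
    simp only [map_sub]; abel
  rw [h4]
  have := norm_sub_le (Qn n (ψ - φ) + (Qn n φ - Q φ)) (Q (ψ - φ))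
  have := norm_add_le (Qn n (ψ - φ)) (Qn n φ - Q φ)
  linarith [h1 (ψ - φ)]

end StrongConvergence

/-! ### Spectral projections characterised by the positive and negative parts of `A - E` -/

section SpecProj

variable {X : Type*}

theorem norm_specProj_le (A : Op X) (E : ℝ) : ‖specProj A E‖ ≤ 1 :=
  Submodule.starProjection_norm_le _

/-- The range of the self-adjoint operator `(A - E)₊` is orthogonal to its kernel, onto which
`specProj` projects. -/
theorem specProj_mul_cfc_pos (A : Op X) (E : ℝ) :
    specProj A E * cfc (fun t : ℝ => max (t - E) 0) A = 0 := by
  have hsa : IsSelfAdjoint (cfc (fun t : ℝ => max (t - E) 0) A : Op X) := cfc_predicate _ _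
  ext1 y
  rw [mul_apply_eq_comp, specProj]
  change _ = (0 : Ell2 X)
  rw [Submodule.starProjection_apply_eq_zero_iff, Submodule.mem_orthogonal]
  intro u hu
  have h1 := hsa.isSymmetric u y
  simp only [ContinuousLinearMap.coe_coe] at h1
  rw [← h1, show (cfc (fun t : ℝ => max (t - E) 0) A : Op X) u = 0 from hu, inner_zero_left]

/-- Since `(A - E)₊ (E - A)₊ = 0`, the range of `(E - A)₊` lies in the kernel onto which `specProj`
projects. -/
theorem specProj_mul_cfc_neg (A : Op X) (E : ℝ) :
    specProj A E * cfc (fun t : ℝ => max (E - t) 0) A = cfc (fun t : ℝ => max (E - t) 0) A := by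
  ext1 y
  rw [mul_apply_eq_comp, specProj, Submodule.starProjection_eq_self_iff]
  change (cfc (fun t : ℝ => max (t - E) 0) A : Op X) _ = 0
  rw [← mul_apply_eq_comp, ← cfc_mul _ _ A]
  have h : (fun t : ℝ => max (t - E) 0 * max (E - t) 0) = fun _ => 0 := by
    ext t
    rcases le_total t E with h | h
    · rw [max_eq_right (by linarith : t - E ≤ 0), zero_mul]
    · rw [max_eq_right (by linarith : E - t ≤ 0), mul_zero]
  rw [h]
  simp

theorem cfc_pos_sub_cfc_neg {A : Op X} (hA : IsSelfAdjoint A) (E : ℝ) :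
    (cfc (fun t : ℝ => max (t - E) 0) A : Op X) - cfc (fun t : ℝ => max (E - t) 0) A
      = A - (E : ℂ) • 1 := by
  rw [← cfc_sub _ _ A]
  have h : (fun t : ℝ => max (t - E) 0 - max (E - t) 0) = fun t => t - E := by
    ext t
    rcases le_total t E with h | h
    · rw [max_eq_right (by linarith : t - E ≤ 0), max_eq_left (by linarith : 0 ≤ E - t)]; ring
    · rw [max_eq_right (by linarith : E - t ≤ 0), max_eq_left (by linarith : 0 ≤ t - E)]; ring
  rw [h, cfc_sub _ _ A, cfc_id' ℝ A, cfc_const E A, Algebra.algebraMap_eq_smul_one]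
  rfl

theorem spectrum_subset_Icc {A : Op X} {M : ℝ} (hM : ‖A‖ ≤ M) : spectrum ℝ A ⊆ Icc (-M) M := by
  intro t ht
  rw [mem_Icc, ← abs_le]
  refine (spectrum.norm_le_norm_mul_of_mem ht).trans ?_
  refine (mul_le_of_le_one_right (norm_nonneg _) ?_).trans hM
  -- Only `‖1‖ ≤ 1` is available, because `X` may be empty and `ℓ²(X)` trivial.
  exact ContinuousLinearMap.norm_id_le

theorem tendsto_cfc_of_tendsto {ι : Type*} {l : Filter ι} {A : Op X} {An : ι → Op X}
    (hA : IsSelfAdjoint A) (hAn : ∀ᶠ n in l, IsSelfAdjoint (An n)) (h : Tendsto An l (𝓝 A))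
    {f : ℝ → ℝ} (hf : Continuous f) : Tendsto (fun n => cfc f (An n)) l (𝓝 (cfc f A)) := by
  have hb : ∀ᶠ n in l, ‖An n‖ ≤ ‖A‖ + 1 :=
    (h.norm.eventually (gt_mem_nhds (lt_add_one ‖A‖))).mono fun n hn => le_of_lt hn
  exact Filter.Tendsto.cfc (isCompact_Icc (a := -(‖A‖ + 1)) (b := ‖A‖ + 1)) f h
    (hb.mono fun n hn => spectrum_subset_Icc hn) hAn
    (spectrum_subset_Icc (by linarith)) hA hf.continuousOn

/-- If `A_n → A` in norm and `E` is not an eigenvalue of `A`, then the contractions `Q_n`, which act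
like spectral projections of `A_n`, converge strongly to the spectral projection of `A`. -/
theorem tendsto_specProj_of_mul_eq {ι : Type*} {l : Filter ι} {A : Op X} {An Qn : ι → Op X} {E : ℝ}
    (hA : IsSelfAdjoint A) (hAn : ∀ᶠ n in l, IsSelfAdjoint (An n)) (h : Tendsto An l (𝓝 A))
    (hE : ∀ v, A v = (E : ℂ) • v → v = 0)
    (hQn : ∀ᶠ n in l, ‖Qn n‖ ≤ 1 ∧ Qn n * cfc (fun t : ℝ => max (t - E) 0) (An n) = 0 ∧
      Qn n * cfc (fun t : ℝ => max (E - t) 0) (An n) = cfc (fun t : ℝ => max (E - t) 0) (An n))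
    (ψ : Ell2 X) : Tendsto (fun n => Qn n ψ) l (𝓝 (specProj A E ψ)) := by
  refine tendsto_apply_of_mul_eq (tendsto_cfc_of_tendsto hA hAn h (by fun_prop))
    (tendsto_cfc_of_tendsto hA hAn h (by fun_prop)) hQn (norm_specProj_le A E)
    (specProj_mul_cfc_pos A E) (specProj_mul_cfc_neg A E)
    (ContinuousLinearMap.dense_range_sup_range (cfc_predicate _ _) (cfc_predicate _ _) ?_) ψ
  -- A vector killed by both parts is killed by their difference `A - E`, so it is an eigenvector
  -- unless it vanishes.
  intro v h1 h2
  refine hE v ?_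
  have h3 := congrArg (fun T : Op X => T v) (cfc_pos_sub_cfc_neg hA E)
  simp only [sub_apply, h1, h2, sub_zero] at h3
  exact (sub_eq_zero.1 h3.symm)

theorem cfc_unitary_conj {B : Type*} [CStarAlgebra B] {a : B} (ha : IsSelfAdjoint a) {u : B}
    (hu : u ∈ unitary B) {f : ℝ → ℝ} (hf : Continuous f) :
    cfc f (u * a * star u) = u * cfc f a * star u := by
  have h := StarAlgHomClass.map_cfc (R := ℝ) (S := ℝ) (Unitary.conjStarAlgAut ℝ B ⟨u, hu⟩) f a
    hf.continuousOn (by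
      change Continuous fun x => u * x * star u
      fun_prop) ha (ha.conjugate u)
  exact h.symm

/-- The functional calculus commutes with unitary conjugation, so the relations for `A` carry over.
They are all that the convergence criterion asks for; the conjugate need not be identified with
`specProj (U * A * star U) E`. -/
theorem conj_specProj_properties {A : Op X} (hA : IsSelfAdjoint A) {U : Op X}
    (hU : U ∈ unitary (Op X)) (E : ℝ) :
    ‖U * specProj A E * star U‖ ≤ 1 ∧
    U * specProj A E * star U * cfc (fun t : ℝ => max (t - E) 0) (U * A * star U) = 0 ∧
    U * specProj A E * star U * cfc (fun t : ℝ => max (E - t) 0) (U * A * star U)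
      = cfc (fun t : ℝ => max (E - t) 0) (U * A * star U) := by
  have hUU : ∀ B C : Op X, U * B * star U * (U * C * star U) = U * (B * C) * star U := by
    intro B C
    calc U * B * star U * (U * C * star U) = U * B * (star U * U) * C * star U := by
          simp only [mul_assoc]
      _ = _ := by rw [Unitary.star_mul_self_of_mem hU, mul_one]; simp only [mul_assoc]
  refine ⟨?_, ?_, ?_⟩
  · have h1 := CStarRing.norm_mem_unitary_mul (specProj A E) hU
    rw [CStarRing.norm_mul_mem_unitary _ (Unitary.star_mem hU), h1]
    exact norm_specProj_le A E
  · rw [cfc_unitary_conj hA hU (by fun_prop), hUU, specProj_mul_cfc_pos, mul_zero, zero_mul]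
  · rw [cfc_unitary_conj hA hU (by fun_prop), hUU, specProj_mul_cfc_neg]

end SpecProj

/-! ### The propagator is unitary and almost conserves the energy -/

section Propagator

variable {X : Type*} {ε : ℝ} {A U : ℝ → Op X}

theorem IsPropagator.hasDerivWithinAt (hε : ε ≠ 0) (hU : IsPropagator ε A U) {s : ℝ}
    (hs : s ∈ Icc (0 : ℝ) 1) :
    HasDerivWithinAt U ((Complex.I * (ε : ℂ))⁻¹ • (A s * U s)) (Icc 0 1) s := by
  have hne : Complex.I * (ε : ℂ) ≠ 0 := mul_ne_zero Complex.I_ne_zero (by exact_mod_cast hε)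
  obtain ⟨U', h1, h2⟩ := hU.2 s hs
  rwa [← h2, inv_smul_smul₀ hne]

theorem IsPropagator.hasDerivWithinAt_star (hε : ε ≠ 0) (hU : IsPropagator ε A U) {s : ℝ}
    (hs : s ∈ Icc (0 : ℝ) 1) (hA : IsSelfAdjoint (A s)) :
    HasDerivWithinAt (fun t => star (U t)) (-((Complex.I * (ε : ℂ))⁻¹ • (star (U s) * A s)))
      (Icc 0 1) s := by
  refine (hU.hasDerivWithinAt hε hs).star.congr_deriv ?_
  rw [star_smul, star_mul, hA.star_eq, ← neg_smul]
  congr 1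
  simp

theorem IsPropagator.star_mul_self (hε : ε ≠ 0) (hA : ∀ s ∈ Icc (0 : ℝ) 1, IsSelfAdjoint (A s))
    (hU : IsPropagator ε A U) {s : ℝ} (hs : s ∈ Icc (0 : ℝ) 1) : star (U s) * U s = 1 := by
  have hd : ∀ t ∈ Icc (0 : ℝ) 1,
      HasDerivWithinAt (fun t => star (U t) * U t) 0 (Icc 0 1) t := by
    intro t ht
    refine ((hU.hasDerivWithinAt_star hε ht (hA t ht)).mul
      (hU.hasDerivWithinAt hε ht)).congr_deriv ?_
    simp only [neg_mul, smul_mul_assoc, mul_smul_comm, mul_assoc, neg_add_cancel]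
  have h := (convex_Icc (0 : ℝ) 1).norm_image_sub_le_of_norm_hasDerivWithin_le (C := 0) hd
    (fun t _ => by simp) (left_mem_Icc.2 zero_le_one) hs
  rw [zero_mul, norm_le_zero_iff, sub_eq_zero] at h
  rw [h, hU.1, star_one, one_mul]

/-- In infinite dimension `U^* U = 1` does not give `U U^* = 1`. Instead, `U U^*` and the constant
`1` both solve the linear equation `Y' = [cA, Y]` with the same initial value, so they agree. -/
theorem IsPropagator.self_mul_star (hε : ε ≠ 0) (hAc : ContinuousOn A (Icc 0 1))
    (hA : ∀ s ∈ Icc (0 : ℝ) 1, IsSelfAdjoint (A s))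
    (hU : IsPropagator ε A U) {s : ℝ} (hs : s ∈ Icc (0 : ℝ) 1) : U s * star (U s) = 1 := by
  obtain ⟨M, hM⟩ := isCompact_Icc.exists_bound_of_continuousOn
    (hAc.const_smul ((Complex.I * (ε : ℂ))⁻¹))
  set c : ℂ := (Complex.I * (ε : ℂ))⁻¹
  have hlip : ∀ t ∈ Ico (0 : ℝ) 1, LipschitzOnWith (2 * M.toNNReal)
      (fun Y : Op X => (c • A t) * Y - Y * (c • A t)) univ := by
    intro t ht
    refine LipschitzWith.lipschitzOnWith (LipschitzWith.of_dist_le_mul fun x y => ?_)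
    have hM' : ‖c • A t‖ ≤ M.toNNReal := (hM t ⟨ht.1, ht.2.le⟩).trans (Real.le_coe_toNNReal M)
    rw [dist_eq_norm, dist_eq_norm]
    have e : (c • A t) * x - x * (c • A t) - ((c • A t) * y - y * (c • A t))
        = (c • A t) * (x - y) - (x - y) * (c • A t) := by
      rw [mul_sub, sub_mul]; abel
    rw [e]
    have h1 : ‖(c • A t) * (x - y)‖ ≤ M.toNNReal * ‖x - y‖ :=
      (norm_mul_le _ _).trans (by gcongr)
    have h2 : ‖(x - y) * (c • A t)‖ ≤ ‖x - y‖ * M.toNNReal :=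
      (norm_mul_le _ _).trans (by gcongr)
    have h3 := norm_sub_le ((c • A t) * (x - y)) ((x - y) * (c • A t))
    push_cast
    linarith
  have hd : ∀ t ∈ Icc (0 : ℝ) 1, HasDerivWithinAt (fun t => U t * star (U t))
      ((c • A t) * (U t * star (U t)) - (U t * star (U t)) * (c • A t)) (Icc 0 1) t := by
    intro t ht
    refine ((hU.hasDerivWithinAt hε ht).mul
      (hU.hasDerivWithinAt_star hε ht (hA t ht))).congr_deriv ?_
    simp only [mul_neg, smul_mul_assoc, mul_smul_comm, mul_assoc, sub_eq_add_neg, c]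
  have hright : ∀ t ∈ Ico (0 : ℝ) 1, HasDerivWithinAt (fun t => U t * star (U t))
      ((c • A t) * (U t * star (U t)) - (U t * star (U t)) * (c • A t)) (Ici t) t := fun t ht =>
    (hd t ⟨ht.1, ht.2.le⟩).mono_of_mem_nhdsWithin (Icc_mem_nhdsGE_of_mem ht)
  have h := ODE_solution_unique_of_mem_Icc_right (v := fun t Y => (c • A t) * Y - Y * (c • A t))
    (s := fun _ => univ) (f := fun t => U t * star (U t)) (g := fun _ => 1) hlip
    (fun t ht => (hd t ht).continuousWithinAt) hright (fun _ _ => mem_univ _)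
    continuousOn_const (fun t _ => (hasDerivWithinAt_const t (Ici t) (1 : Op X)).congr_deriv (by simp))
    (fun _ _ => mem_univ _) (by simp [hU.1])
  exact h hs

theorem IsPropagator.mem_unitary (hε : ε ≠ 0) (hAc : ContinuousOn A (Icc 0 1))
    (hA : ∀ s ∈ Icc (0 : ℝ) 1, IsSelfAdjoint (A s))
    (hU : IsPropagator ε A U) {s : ℝ} (hs : s ∈ Icc (0 : ℝ) 1) : U s ∈ unitary (Op X) :=
  Unitary.mem_iff.2 ⟨hU.star_mul_self hε hA hs, hU.self_mul_star hε hAc hA hs⟩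

/-- Energy balance: `∂_s (U(s)^* A(s) U(s)) = U(s)^* A'(s) U(s)`, so that the energy operator changes
at most by the total variation of the generator, however small `ε` is. -/
theorem IsPropagator.norm_conj_sub_le (hε : ε ≠ 0) {A' : ℝ → Op X}
    (hA' : ∀ s ∈ Icc (0 : ℝ) 1, HasDerivWithinAt A (A' s) (Icc 0 1) s)
    (hA : ∀ s ∈ Icc (0 : ℝ) 1, IsSelfAdjoint (A s)) {C : ℝ}
    (hC : ∀ s ∈ Icc (0 : ℝ) 1, ‖A' s‖ ≤ C)
    (hU : IsPropagator ε A U) {s : ℝ} (hs : s ∈ Icc (0 : ℝ) 1) :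
    ‖U s * A 0 * star (U s) - A s‖ ≤ C := by
  have hAc : ContinuousOn A (Icc 0 1) := fun t ht => (hA' t ht).continuousWithinAt
  have hC0 : 0 ≤ C := (norm_nonneg _).trans (hC s hs)
  have hunit : ∀ t ∈ Icc (0 : ℝ) 1, U t ∈ unitary (Op X) := fun t ht =>
    hU.mem_unitary hε hAc hA ht
  -- The two terms of order `1/ε` cancel, because `A t` commutes with itself; this is why the bound
  -- is free of `ε`.
  have hd : ∀ t ∈ Icc (0 : ℝ) 1, HasDerivWithinAt (fun t => star (U t) * A t * U t)
      (star (U t) * A' t * U t) (Icc 0 1) t := by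
    intro t ht
    refine (((hU.hasDerivWithinAt_star hε ht (hA t ht)).mul (hA' t ht)).mul
      (hU.hasDerivWithinAt hε ht)).congr_deriv ?_
    simp only [Pi.mul_apply, add_mul, neg_mul, smul_mul_assoc, mul_smul_comm, mul_assoc]
    abel
  have h := (convex_Icc (0 : ℝ) 1).norm_image_sub_le_of_norm_hasDerivWithin_le (C := C) hd
    (fun t ht => by
      rw [CStarRing.norm_mul_mem_unitary _ (hunit t ht),
        CStarRing.norm_mem_unitary_mul _ (Unitary.star_mem (hunit t ht))]
      exact hC t ht) (left_mem_Icc.2 zero_le_one) hs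
  have hs1 : C * ‖s - 0‖ ≤ C := by
    rw [sub_zero, Real.norm_of_nonneg hs.1]
    exact mul_le_of_le_one_right hC0 hs.2
  have e : U s * A 0 * star (U s) - A s
      = -(U s * (star (U s) * A s * U s - star (U 0) * A 0 * U 0) * star (U s)) := by
    have h1 := hU.self_mul_star hε hAc hA hs
    have h2 : U s * (star (U s) * A s * U s) * star (U s) = A s := by
      calc _ = (U s * star (U s)) * A s * (U s * star (U s)) := by simp only [mul_assoc]
        _ = A s := by rw [h1, one_mul, mul_one]
    rw [mul_sub, sub_mul, h2, hU.1]
    simp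
  rw [e, norm_neg, CStarRing.norm_mul_mem_unitary _ (Unitary.star_mem (hunit s hs)),
    CStarRing.norm_mem_unitary_mul _ (hunit s hs)]
  exact h.trans hs1

end Propagator

/-! ### Matrix elements and restrictions -/

section Kernel

variable {X : Type*} [DecidableEq X]

theorem inner_delta_left (x : X) (v : Ell2 X) :
    inner ℂ (delta x) v = (show lp (fun _ : X => ℂ) 2 from v) x := by
  have h : inner ℂ (lp.single 2 x (1 : ℂ) : lp (fun _ : X => ℂ) 2)
      (show lp (fun _ : X => ℂ) 2 from v) = (show lp (fun _ : X => ℂ) 2 from v) x := by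
    rw [lp.inner_single_left]
    simp
  exact h

theorem eq_zero_of_inner_delta {v : Ell2 X} (h : ∀ x, inner ℂ (delta x) v = 0) : v = 0 := by
  have h1 : (show lp (fun _ : X => ℂ) 2 from v) = 0 := by
    ext x
    rw [← inner_delta_left, h]
    rfl
  exact h1

theorem hasSum_inner_delta (v w : Ell2 X) :
    HasSum (fun z : X => inner ℂ v (delta z) * inner ℂ (delta z) w) (inner ℂ v w) := by
  have hb : (Submodule.span ℂ (range fun x : X => (delta x : Ell2 X)))ᗮ = ⊥ := by
    rw [Submodule.eq_bot_iff]
    intro v hv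
    rw [Submodule.mem_orthogonal] at hv
    exact eq_zero_of_inner_delta fun x => hv _ (Submodule.subset_span (mem_range_self x))
  have h := (HilbertBasis.mkOfOrthogonalEqBot (orthonormal_delta X) hb).hasSum_inner_mul_inner v w
  simpa using h

/-- Parseval in the basis `δ_z`; on a countable `X` it makes measurability of matrix elements pass
to products. -/
theorem hasSum_kernel_mul (A B : Op X) (x y : X) :
    HasSum (fun z => kernel A x z * kernel B z y) (kernel (A * B) x y) := by
  have h := hasSum_inner_delta (ContinuousLinearMap.adjoint A (delta x)) (B (delta y))
  simp only [ContinuousLinearMap.adjoint_inner_left] at h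
  exact h

theorem extendByZero_delta (Θ : Set X) (x : Θ) : extendByZero Θ (delta x) = delta (x : X) :=
  (((orthonormal_delta X).comp (Subtype.val : Θ → X)
    Subtype.val_injective).orthogonalFamily.linearIsometry_apply_single
      (i := x) (1 : ℂ)).trans (by simp)

theorem kernel_restrictTo (K : Op X) (Θ : Set X) (x y : Θ) :
    kernel (restrictTo K Θ) x y = kernel K x y := by
  rw [kernel, restrictTo, ContinuousLinearMap.comp_apply, ContinuousLinearMap.adjoint_inner_right]
  simp only [ContinuousLinearMap.comp_apply, LinearIsometry.coe_toContinuousLinearMap,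
    extendByZero_delta]
  rfl

theorem IsSelfAdjoint.restrictTo {K : Op X} (hK : IsSelfAdjoint K) (Θ : Set X) :
    IsSelfAdjoint (restrictTo K Θ) :=
  hK.adjoint_conj _

theorem norm_restrictTo_le (K : Op X) (Θ : Set X) : ‖restrictTo K Θ‖ ≤ ‖K‖ := by
  have h1 : ‖(extendByZero Θ).toContinuousLinearMap‖ ≤ 1 :=
    (extendByZero Θ).norm_toContinuousLinearMap_le
  have h2 : ‖ContinuousLinearMap.adjoint (extendByZero Θ).toContinuousLinearMap‖ ≤ 1 := by
    rwa [LinearIsometryEquiv.norm_map]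
  calc ‖_root_.restrictTo K Θ‖ ≤ 1 * (‖K‖ * 1) :=
        (ContinuousLinearMap.opNorm_comp_le _ _).trans (mul_le_mul h2
          ((ContinuousLinearMap.opNorm_comp_le _ _).trans (by gcongr)) (norm_nonneg _) zero_le_one)
    _ = ‖K‖ := by ring

/-- An eigenvector of `K` with amplitude at `x` yields one of its restriction to the whole set. -/
theorem exists_eigenvector_restrictTo_univ {K : Op X} {E : ℂ} {v : Ell2 X} (hv : K v = E • v) :
    ∃ w : Ell2 (univ : Set X), restrictTo K univ w = E • w ∧
      ∀ x, inner ℂ (delta (⟨x, mem_univ x⟩ : (univ : Set X))) w = inner ℂ (delta x) v := by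
  set J := (extendByZero (univ : Set X)).toContinuousLinearMap with hJ
  have hJJ : ContinuousLinearMap.adjoint J ∘L J = 1 := by
    rw [← ContinuousLinearMap.norm_map_iff_adjoint_comp_self]
    exact (extendByZero (univ : Set X)).norm_map
  have hin : ∀ x (u : Ell2 X), inner ℂ (delta (⟨x, mem_univ x⟩ : (univ : Set X)))
      (ContinuousLinearMap.adjoint J u) = inner ℂ (delta x) u := by
    intro x u
    rw [ContinuousLinearMap.adjoint_inner_right, hJ, LinearIsometry.coe_toContinuousLinearMap,
      extendByZero_delta]
  -- For the whole set the inclusion is onto: `J^*` preserves coordinates and `J^* J = 1`, so both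
  -- sides have the same coordinates.
  have hsurj : J (ContinuousLinearMap.adjoint J v) = v := by
    refine sub_eq_zero.1 (eq_zero_of_inner_delta fun x => ?_)
    rw [← hin, map_sub, ← ContinuousLinearMap.comp_apply (ContinuousLinearMap.adjoint J) J, hJJ]
    simp
  refine ⟨ContinuousLinearMap.adjoint J v, ?_, fun x => hin x v⟩
  rw [restrictTo, ContinuousLinearMap.comp_apply, ContinuousLinearMap.comp_apply, ← hJ, hsurj, hv,
    map_smul]

end Kernel

/-! ### Eigenvectors and the Green function -/

section Green

variable {X : Type*}

theorem isUnit_sub_smul_one {K : Op X} (hK : IsSelfAdjoint K) {z : ℂ} (hz : z.im ≠ 0) :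
    IsUnit (K - z • (1 : Op X)) := by
  have h : z ∉ spectrum ℂ K := fun h => hz (hK.im_eq_zero_of_mem_spectrum h)
  rw [spectrum.notMem_iff, Algebra.algebraMap_eq_smul_one, ← neg_sub, IsUnit.neg_iff] at h
  exact h

/-- The diagonal Green function blows up at an eigenvalue with an eigenvector that does not vanish
at `x`. -/
theorem le_norm_green_of_eigenvector [DecidableEq X] {K : Op X} (hK : IsSelfAdjoint K) {E η : ℝ} (hη : 0 < η)
    {w : Ell2 X} (hw : K w = (E : ℂ) • w) (x : X) :
    ‖inner ℂ (delta x) w‖ ^ 2 / (‖w‖ ^ 2 * η) ≤ ‖green K ((E : ℂ) + (η : ℂ) * Complex.I) x x‖ := by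
  set z : ℂ := (E : ℂ) + (η : ℂ) * Complex.I with hz
  have hzim : z.im = η := by simp [hz]
  set φ : Ell2 X := Ring.inverse (K - z • (1 : Op X)) (delta x) with hφ
  have hφx : K φ - z • φ = delta x := by
    have h := Ring.mul_inverse_cancel _ (isUnit_sub_smul_one hK (z := z) (by rw [hzim]; exact hη.ne'))
    have h1 := congrArg (fun T : Op X => T (delta x)) h
    exact h1
  have hgreen : green K z x x = inner ℂ (delta x) φ := rfl
  have hre : (inner ℂ φ (K φ)).im = 0 := by
    rw [← Complex.conj_eq_iff_im, inner_conj_symm]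
    exact hK.isSymmetric φ φ
  have hφφ : inner ℂ φ φ = ((‖φ‖ ^ 2 : ℝ) : ℂ) := by
    rw [inner_self_eq_norm_sq_to_K]
    norm_cast
  -- Pairing `δ_x = (K - z) φ` with `φ` yields this identity; pairing it with `w` bounds `‖φ‖` from
  -- below by a multiple of `1/η`.
  have him : (green K z x x).im = η * ‖φ‖ ^ 2 := by
    rw [hgreen, ← inner_conj_symm, Complex.conj_im, ← hφx, inner_sub_right, inner_smul_right,
      hφφ, Complex.sub_im, hre, Complex.im_mul_ofReal, hzim]
    ring
  have hwd : ‖inner ℂ (delta x) w‖ ≤ η * ‖w‖ * ‖φ‖ := by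
    rw [← inner_conj_symm, RCLike.norm_conj, ← hφx, inner_sub_right, inner_smul_right]
    have h1 : inner ℂ w (K φ) = (E : ℂ) * inner ℂ w φ := by
      have h2 := hK.isSymmetric w φ
      simp only [ContinuousLinearMap.coe_coe] at h2
      rw [← h2, hw, inner_smul_left, Complex.conj_ofReal]
    have h3 : (E : ℂ) * inner ℂ w φ - z * inner ℂ w φ
        = -((η : ℂ) * Complex.I) * inner ℂ w φ := by rw [hz]; ring
    rw [h1, h3, norm_mul, norm_neg, norm_mul, Complex.norm_I, mul_one, Complex.norm_real,
      Real.norm_of_nonneg hη.le, mul_assoc]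
    gcongr
    exact norm_inner_le_norm _ _
  refine le_trans ?_ ((le_abs_self _).trans (Complex.abs_im_le_norm _))
  rw [him]
  -- For `w = 0` the left side is `0 / 0 = 0`.
  rcases eq_or_ne w 0 with rfl | hw0
  · simp only [inner_zero_right, norm_zero]
    norm_num
    positivity
  · have : 0 < ‖w‖ := norm_pos_iff.2 hw0
    rw [div_le_iff₀ (by positivity)]
    calc ‖inner ℂ (delta x) w‖ ^ 2 ≤ (η * ‖w‖ * ‖φ‖) ^ 2 := by gcongr
      _ = _ := by ring

theorem greenBoundaryPow_eq_top [DecidableEq X] {K : Op X} (hK : IsSelfAdjoint K) {E q : ℝ} (hq : 0 < q)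
    {w : Ell2 X} (hw : K w = (E : ℂ) • w) {x : X} (hx : inner ℂ (delta x) w ≠ 0) :
    greenBoundaryPow K E q x x = ∞ := by
  have hw0 : w ≠ 0 := by
    rintro rfl
    simp at hx
  have hc : 0 < ‖inner ℂ (delta x) w‖ ^ 2 / ‖w‖ ^ 2 := by
    have := norm_pos_iff.2 hx
    have := norm_pos_iff.2 hw0
    positivity
  have h1 : Tendsto (fun η : ℝ => ‖green K ((E : ℂ) + (η : ℂ) * Complex.I) x x‖) (𝓝[>] 0) atTop := by
    refine tendsto_atTop_mono' _ ?_ ((tendsto_inv_nhdsGT_zero (𝕜 := ℝ)).const_mul_atTop hc)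
    filter_upwards [self_mem_nhdsWithin] with η hη
    refine le_of_eq_of_le ?_ (le_norm_green_of_eigenvector hK hη hw x)
    rw [← div_eq_mul_inv, div_div]
  have h2 : Tendsto (fun η : ℝ => ‖green K ((E : ℂ) + (η : ℂ) * Complex.I) x x‖ₑ) (𝓝[>] 0)
      (𝓝 ∞) := by
    simp only [← ofReal_norm]
    exact ENNReal.tendsto_ofReal_nhds_top.2 h1
  have h3 := (ENNReal.continuous_rpow_const (y := q)).tendsto ∞ |>.comp h2
  rw [ENNReal.top_rpow_of_pos hq] at h3
  exact h3.liminf_eq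

end Green

/-! ### Measurability of the event that a given energy is an eigenvalue -/

/-- `‖v - A²v‖² = ‖v‖² - 2‖Av‖² + ‖A²v‖²`, and the last term is at most `‖Av‖²`. Contractivity is
what the mean ergodic theorem requires. -/
theorem norm_one_sub_mul_self_le {X : Type*} {A : Op X} (hA : IsSelfAdjoint A) (h1 : ‖A‖ ≤ 1) :
    ‖1 - A * A‖ ≤ 1 := by
  refine ContinuousLinearMap.opNorm_le_bound _ zero_le_one fun v => ?_
  rw [one_mul]
  refine le_of_sq_le_sq ?_ (norm_nonneg v)
  have hAA : ‖A (A v)‖ ≤ ‖A v‖ := (A.le_of_opNorm_le h1 _).trans_eq (one_mul _)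
  have hin : RCLike.re (inner ℂ v (A (A v))) = ‖A v‖ ^ 2 := by
    have h := hA.isSymmetric v (A v)
    simp only [ContinuousLinearMap.coe_coe] at h
    rw [← h, inner_self_eq_norm_sq]
  change ‖v - A (A v)‖ ^ 2 ≤ ‖v‖ ^ 2
  rw [norm_sub_sq (𝕜 := ℂ), hin]
  have : ‖A (A v)‖ ^ 2 ≤ ‖A v‖ ^ 2 := by gcongr
  nlinarith [sq_nonneg ‖A v‖]

section Measurability

variable {X : Type*} [DecidableEq X] {Ω : Type*} [MeasurableSpace Ω] {A B : Ω → Op X}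

theorem measurable_kernel_one (x y : X) : Measurable fun _ : Ω => kernel (1 : Op X) x y :=
  measurable_const

theorem measurable_kernel_sub (hA : ∀ x y, Measurable fun ω => kernel (A ω) x y)
    (hB : ∀ x y, Measurable fun ω => kernel (B ω) x y) (x y : X) :
    Measurable fun ω => kernel (A ω - B ω) x y := by
  simp only [kernel, sub_apply, inner_sub_right]
  exact (hA x y).sub (hB x y)

theorem measurable_kernel_smul (c : ℂ) (hA : ∀ x y, Measurable fun ω => kernel (A ω) x y)
    (x y : X) : Measurable fun ω => kernel (c • A ω) x y := by
  simp only [kernel, smul_apply, inner_smul_right]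
  exact (hA x y).const_mul c

theorem measurable_kernel_mul [Countable X] (hA : ∀ x y, Measurable fun ω => kernel (A ω) x y)
    (hB : ∀ x y, Measurable fun ω => kernel (B ω) x y) (x y : X) :
    Measurable fun ω => kernel (A ω * B ω) x y :=
  measurable_of_tendsto_metrizable' (atTop : Filter (Finset X))
    (fun s => Finset.measurable_fun_sum s fun z _ => (hA x z).mul (hB z y))
    (tendsto_pi_nhds.2 fun ω => hasSum_kernel_mul (A ω) (B ω) x y)

theorem measurable_kernel_pow [Countable X] (hA : ∀ x y, Measurable fun ω => kernel (A ω) x y)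
    (n : ℕ) : ∀ x y : X, Measurable fun ω => kernel (A ω ^ n) x y := by
  induction n with
  | zero => simpa only [pow_zero] using measurable_kernel_one
  | succ n ih => simpa only [pow_succ] using measurable_kernel_mul ih hA

/-- The quantifier over `w` is uncountable, so the event is rewritten as `⟨δ_x, P δ_x⟩ ≠ 0`, with
`P` the projection onto the eigenspace. By the mean ergodic theorem this number is the limit of
averages of `⟨δ_x, T^k δ_x⟩` for a contraction `T` with the eigenspace as fixed space, and these
matrix elements are measurable. -/
theorem measurableSet_exists_eigenvector [Countable X] {K : Ω → Op X}
    (hK : ∀ x y, Measurable fun ω => kernel (K ω) x y) (hsa : ∀ ω, IsSelfAdjoint (K ω)) {C : ℝ}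
    (hC : ∀ ω, ‖K ω‖ ≤ C) (E : ℝ) (x : X) :
    MeasurableSet {ω | ∃ w, K ω w = (E : ℂ) • w ∧ inner ℂ (delta x) w ≠ 0} := by
  -- Chosen so that `(K - E)/M` is a contraction, with `M > 0` in all cases.
  set M : ℝ := |C| + |E| + 1 with hM
  have hM0 : 0 < M := by positivity
  set A : Ω → Op X := fun ω => ((M⁻¹ : ℝ) : ℂ) • (K ω - (E : ℂ) • 1) with hAdef
  have hA : ∀ ω, IsSelfAdjoint (A ω) := fun ω =>
    IsSelfAdjoint.smul (Complex.conj_ofReal _)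
      ((hsa ω).sub (IsSelfAdjoint.smul (Complex.conj_ofReal _) (IsSelfAdjoint.one _)))
  have hA1 : ∀ ω, ‖A ω‖ ≤ 1 := by
    intro ω
    rw [hAdef, norm_smul, Complex.norm_real, Real.norm_of_nonneg (by positivity),
      inv_mul_le_iff₀ hM0, mul_one]
    refine (norm_sub_le _ _).trans ?_
    have h1 : ‖(E : ℂ) • (1 : Op X)‖ ≤ |E| := by
      rw [norm_smul, Complex.norm_real, Real.norm_eq_abs]
      exact mul_le_of_le_one_right (abs_nonneg E) ContinuousLinearMap.norm_id_le
    linarith [hC ω, le_abs_self C]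
  set T : Ω → Op X := fun ω => 1 - A ω * A ω with hT
  have hT1 : ∀ ω, ‖T ω‖ ≤ 1 := fun ω => norm_one_sub_mul_self_le (hA ω) (hA1 ω)
  have hTmeas : ∀ y z, Measurable fun ω => kernel (T ω) y z := by
    have hAmeas : ∀ y z, Measurable fun ω => kernel (A ω) y z :=
      measurable_kernel_smul _ (measurable_kernel_sub hK
        (measurable_kernel_smul _ measurable_kernel_one))
    exact measurable_kernel_sub measurable_kernel_one (measurable_kernel_mul hAmeas hAmeas)
  -- `T w = w` means `A² w = 0`, which forces `A w = 0` since `‖A w‖² = ⟨w, A² w⟩`.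
  have hfix : ∀ ω w, T ω w = w ↔ K ω w = (E : ℂ) • w := by
    intro ω w
    have h1 : T ω w = w - A ω (A ω w) := rfl
    have h2 : A ω w = ((M⁻¹ : ℝ) : ℂ) • (K ω w - (E : ℂ) • w) := rfl
    have h3 : A ω w = 0 ↔ K ω w = (E : ℂ) • w := by
      rw [h2, smul_eq_zero_iff_right (by exact_mod_cast (inv_pos.2 hM0).ne'), sub_eq_zero]
    rw [h1, sub_eq_self, ← h3]
    refine ⟨fun h => ?_, fun h => by rw [h, map_zero]⟩
    have h4 := (hA ω).isSymmetric w (A ω w)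
    simp only [ContinuousLinearMap.coe_coe] at h4
    rw [h, inner_zero_right] at h4
    exact inner_self_eq_zero.1 h4
  set V : Ω → Submodule ℂ (Ell2 X) := fun ω =>
    (T ω : Ell2 X →ₗ[ℂ] Ell2 X).eqLocus ((1 : Op X) : Ell2 X →ₗ[ℂ] Ell2 X) with hV
  have hVmem : ∀ ω w, w ∈ V ω ↔ K ω w = (E : ℂ) • w := fun ω w => hfix ω w
  set f : Ω → ℂ := fun ω => inner ℂ (delta x) ((V ω).starProjection (delta x)) with hf
  have hfmeas : Measurable f := by
    refine measurable_of_tendsto_metrizable (f := fun (n : ℕ) ω => inner ℂ (delta x)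
      (birkhoffAverage ℂ (T ω) id n (delta x))) (fun n => ?_) (tendsto_pi_nhds.2 fun ω => ?_)
    · have h : ∀ ω, inner ℂ (delta x) (birkhoffAverage ℂ (T ω) id n (delta x))
          = (n : ℂ)⁻¹ * ∑ k ∈ Finset.range n, kernel (T ω ^ k) x x := by
        intro ω
        simp only [birkhoffAverage, birkhoffSum, inner_smul_right, inner_sum, kernel, id]
        simp only [FunLike.coe_pow_eq_iterate]
      simp only [h]
      exact (Finset.measurable_fun_sum _ fun k _ => measurable_kernel_pow hTmeas k x x).const_mul _
    · exact ((innerSL ℂ (delta x)).continuous.tendsto _).comp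
        ((T ω).tendsto_birkhoffAverage_orthogonalProjection (hT1 ω) (delta x))
  -- For an eigenvector `w`, `⟨δ_x, w⟩ = ⟨P δ_x, w⟩`, and `f = ‖P δ_x‖²`; conversely `P δ_x` is the
  -- witness.
  have hset : {ω | ∃ w, K ω w = (E : ℂ) • w ∧ inner ℂ (delta x) w ≠ 0} = f ⁻¹' {0}ᶜ := by
    ext ω
    constructor
    · rintro ⟨w, hw, hx⟩ h0
      refine hx ?_
      have h1 : (V ω).starProjection (delta x) = 0 := by
        rw [← inner_self_eq_zero (𝕜 := ℂ), Submodule.inner_starProjection_left_eq_right,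
          Submodule.starProjection_eq_self_iff.2 (Submodule.starProjection_apply_mem _ _)]
        exact h0
      rw [← Submodule.starProjection_eq_self_iff.2 ((hVmem ω w).2 hw),
        ← Submodule.inner_starProjection_left_eq_right, h1, inner_zero_left]
    · intro h
      exact ⟨_, (hVmem ω _).1 (Submodule.starProjection_apply_mem _ _), h⟩
  rw [hset]
  exact hfmeas (measurableSet_singleton _).compl

end Measurability

/-! ### Almost sure absence of the eigenvalue, and the limit of weak driving -/

/-- The fractional moment condition excludes that a given energy is an eigenvalue. -/
theorem FractionalMoment.ae_not_eigenvalue {d : ℕ} {Ω : Type*} [MeasurableSpace Ω] {μ : Measure Ω}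
    {H : Ω → Op (Zd d)} (hmeas : ∀ x y : Zd d, Measurable fun ω => kernel (H ω) x y)
    (hsa : ∀ ω, IsSelfAdjoint (H ω)) {B : ℝ} (hB : ∀ ω, ‖H ω‖ ≤ B) {J : Set ℝ} {q : ℝ} (hq : 0 < q)
    (hfm : FractionalMoment q J H μ) {E : ℝ} (hE : E ∈ J) :
    ∀ᵐ ω ∂μ, ∀ v, H ω v = (E : ℂ) • v → v = 0 := by
  obtain ⟨C, c, -, -, hbound⟩ := hfm
  have hx : ∀ x : (univ : Set (Zd d)), ∀ᵐ ω ∂μ, ¬ ∃ w, restrictTo (H ω) univ w = (E : ℂ) • w ∧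
      inner ℂ (delta x) w ≠ 0 := by
    intro x
    set S := {ω | ∃ w, restrictTo (H ω) univ w = (E : ℂ) • w ∧ inner ℂ (delta x) w ≠ 0} with hS
    have hSm : MeasurableSet S := measurableSet_exists_eigenvector
      (fun y z => by simpa only [kernel_restrictTo] using hmeas y z)
      (fun ω => (hsa ω).restrictTo univ) (fun ω => (norm_restrictTo_le _ _).trans (hB ω)) E x
    -- The integrand is `∞` on `S` while its integral is finite, so `S` must be null.
    have hle : ∞ * μ S ≤ ENNReal.ofReal (C * Real.exp (-c * bulkDist univ (x : Zd d) x)) := by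
      rw [← lintegral_indicator_const hSm]
      refine (lintegral_mono fun ω => ?_).trans (hbound univ E hE x x)
      by_cases hω : ω ∈ S
      · obtain ⟨w, hw, hwx⟩ := hω
        simp only [greenBoundaryPow_eq_top ((hsa ω).restrictTo univ) hq hw hwx, le_top]
      · simp only [indicator_of_notMem hω, zero_le]
    have h0 : μ S = 0 := by
      by_contra h
      rw [ENNReal.top_mul h, top_le_iff] at hle
      exact ENNReal.ofReal_ne_top hle
    exact measure_eq_zero_iff_ae_notMem.1 h0
  filter_upwards [ae_all_iff.2 hx] with ω hω v hv
  obtain ⟨w, hw, hwv⟩ := exists_eigenvector_restrictTo_univ hv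
  refine eq_zero_of_inner_delta fun x => ?_
  by_contra h
  exact hω ⟨x, mem_univ x⟩ ⟨w, hw, by rwa [hwv]⟩

/-- Slow driving follows the spectral projection in the strong sense, in the limit of weak driving, as
long as `E` is not an eigenvalue of the undriven operator. -/
theorem tendsto_propagator_conj_specProj_sub {X : Type*} {H : Op X} {W W' : ℝ → Op X}
    (hH : IsSelfAdjoint H) (hW : ∀ s ∈ Icc (0 : ℝ) 1, IsSelfAdjoint (W s))
    (hW' : ∀ s ∈ Icc (0 : ℝ) 1, HasDerivWithinAt W (W' s) (Icc 0 1) s) {C C' : ℝ}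
    (hC : ∀ s ∈ Icc (0 : ℝ) 1, ‖W s‖ ≤ C) (hC' : ∀ s ∈ Icc (0 : ℝ) 1, ‖W' s‖ ≤ C') {E : ℝ}
    (hE : ∀ v, H v = (E : ℂ) • v → v = 0) {l : Filter (ℝ × ℝ)} (hε : ∀ᶠ a in l, a.1 ≠ 0)
    (hβ : Tendsto Prod.snd l (𝓝 0)) {s : ℝ} (hs : s ∈ Icc (0 : ℝ) 1) (ψ : Ell2 X) :
    Tendsto (fun a : ℝ × ℝ =>
      (propagator a.1 (drivenH H W a.2) s * specProj (drivenH H W a.2 0) E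
          * star (propagator a.1 (drivenH H W a.2) s)) ψ - specProj (drivenH H W a.2 s) E ψ)
      l (𝓝 0) := by
  have hmul : ∀ c : ℝ, Tendsto (fun a : ℝ × ℝ => |a.2| * c) l (𝓝 0) := by
    intro c
    simpa using hβ.abs.mul_const c
  have hself : ∀ β : ℝ, ∀ t ∈ Icc (0 : ℝ) 1, IsSelfAdjoint (drivenH H W β t) :=
    fun β t ht => hH.add (IsSelfAdjoint.smul (Complex.conj_ofReal _) (hW t ht))
  have hderiv : ∀ β : ℝ, ∀ t ∈ Icc (0 : ℝ) 1, HasDerivWithinAt (drivenH H W β)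
      ((β : ℂ) • W' t) (Icc 0 1) t := fun β t ht =>
    ((hW' t ht).const_smul (β : ℂ)).const_add H
  have hcont : ∀ β : ℝ, ContinuousOn (drivenH H W β) (Icc 0 1) := fun β t ht =>
    (hderiv β t ht).continuousWithinAt
  have hsmul_le : ∀ (β : ℝ) {Y : Op X} {c : ℝ}, ‖Y‖ ≤ c → ‖(β : ℂ) • Y‖ ≤ |β| * c := by
    intro β Y c h
    rw [norm_smul, Complex.norm_real, Real.norm_eq_abs]
    gcongr
  have hHs : Tendsto (fun a : ℝ × ℝ => drivenH H W a.2 s) l (𝓝 H) := by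
    rw [tendsto_iff_norm_sub_tendsto_zero]
    refine squeeze_zero (fun _ => norm_nonneg _) (fun a => ?_) (hmul C)
    rw [drivenH, add_sub_cancel_left]
    exact hsmul_le _ (hC s hs)
  have h0 : (0 : ℝ) ∈ Icc (0 : ℝ) 1 := left_mem_Icc.2 zero_le_one
  -- The energy drift is at most `|β| C'`, uniformly in `ε ≠ 0`, so no relation between `ε` and `β`
  -- enters.
  have hconj : Tendsto (fun a : ℝ × ℝ => propagator a.1 (drivenH H W a.2) s * drivenH H W a.2 0
      * star (propagator a.1 (drivenH H W a.2) s)) l (𝓝 H) := by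
    have h : Tendsto (fun a : ℝ × ℝ => propagator a.1 (drivenH H W a.2) s * drivenH H W a.2 0
        * star (propagator a.1 (drivenH H W a.2) s) - drivenH H W a.2 s) l (𝓝 0) := by
      refine squeeze_zero_norm' (hε.mono fun a ha => ?_) (hmul C')
      exact (propagator_spec ha (hcont a.2)).norm_conj_sub_le ha (hderiv a.2) (hself a.2)
        (fun t ht => hsmul_le a.2 (hC' t ht)) hs
    have h1 := h.add hHs
    rw [zero_add] at h1
    exact h1.congr fun a => sub_add_cancel _ _
  have hlim₁ := tendsto_specProj_of_mul_eq hH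
    (Eventually.of_forall fun a : ℝ × ℝ => (hself a.2 0 h0).conjugate _) hconj hE
    (hε.mono fun a ha => conj_specProj_properties (hself a.2 0 h0)
      ((propagator_spec ha (hcont a.2)).mem_unitary ha (hcont a.2) (hself a.2) hs) E) ψ
  have hlim₂ := tendsto_specProj_of_mul_eq hH
    (Eventually.of_forall fun a : ℝ × ℝ => hself a.2 s hs) hHs hE
    (Eventually.of_forall fun a => ⟨norm_specProj_le _ E, specProj_mul_cfc_pos _ E,
      specProj_mul_cfc_neg _ E⟩) ψ
  have h := hlim₁.sub hlim₂
  rwa [sub_self] at h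

theorem theorem1p4
    (d : ℕ) (hd : 1 ≤ d)
    {Ω : Type*} [MeasurableSpace Ω] (μ : Measure Ω) [IsProbabilityMeasure μ]
    (r : ℕ) (H : Ω → Op (Zd d)) (W : Ω → ℝ → Op (Zd d))
    (hHmeas : ∀ x y : Zd d, Measurable fun ω => kernel (H ω) x y)
    (hA1 : SmoothDriving r H W)
    (hA2 : FiniteRangeCorrelations r H μ)
    (Jloc : Set ℝ) (hJ : Jloc.OrdConnected)
    (q : ℝ) (hq0 : 0 < q) (hq1 : q < 1)
    (hA3 : FractionalMoment q Jloc H μ)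
    (p₁ p₂ : ℝ) (hp₁ : 2 * (d : ℝ) + 1 / 2 + (d : ℝ) / q < p₁)
    (hp₂ : max ((d : ℝ) + 1 / 2 + (d : ℝ) / q) (2 * ((d : ℝ) / q)) < p₂)
    (EF : ℝ) (hEF : EF ∈ Jloc) :
    ∀ᵐ ω ∂μ, ∀ s ∈ Icc (0 : ℝ) 1, ∀ ψ : Ell2 (Zd d),
      Tendsto
        (fun a : ℝ × ℝ =>
          (propagator a.1 (drivenH (H ω) (W ω) a.2) s
              * specProj (drivenH (H ω) (W ω) a.2 0) EF
              * star (propagator a.1 (drivenH (H ω) (W ω) a.2) s)) ψ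
            - specProj (drivenH (H ω) (W ω) a.2 s) EF ψ)
        (𝓝[adiabaticRegime p₁ p₂] (0, 0)) (𝓝 0) := by
  obtain ⟨B, hB⟩ := hA1.bound_H
  obtain ⟨C, hC⟩ := hA1.bound_W
  -- The exceptional null set concerns only `H` and `EF`, hence serves all `s` and `ψ` at once.
  filter_upwards [hA3.ae_not_eigenvalue hHmeas hA1.isSelfAdjoint_H hB hq0 hEF] with ω hω s hs ψ
  refine tendsto_propagator_conj_specProj_sub (W' := derivWithin (W ω) (Icc 0 1)) (C := C 0)
    (C' := C 1) (hA1.isSelfAdjoint_H ω) (hA1.isSelfAdjoint_W ω) (fun t ht => ?_) (fun t ht => ?_)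
    (fun t ht => ?_) hω ?_ ?_ hs ψ
  · exact ((hA1.smooth_W ω).differentiableOn (by simp) t ht).hasDerivWithinAt
  · simpa only [iteratedDerivWithin_zero] using hC 0 ω t ht
  · simpa only [iteratedDerivWithin_one] using hC 1 ω t ht
  -- The exponential lower bound of the region keeps `ε` positive.
  · filter_upwards [self_mem_nhdsWithin] with a ha
    exact ((Real.exp_pos _).trans ha.2.1).ne'
  · exact (continuous_snd.tendsto ((0 : ℝ), (0 : ℝ))).mono_left nhdsWithin_le_nhds
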